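/- Let $\mathbb K$ be a field of characteristic $0$ and let $1\le k\le n$ and $0\le \ell\le n$ be integers. Write $[n]=\{1,\dots,n\}$. Let $G_{k,n}\subset \mathbb K[P_J : J\subseteq[n],\ |J|=k]$ be the Plücker ideal of $\mathrm{Gr}(k,n)$, i.e. the kernel of the map sending $P_J$ to the maximal minor $\det(X_J)$, with columns $J$, of a $k\times n$ matrix $X=(x_{i,j})$ of indeterminates. Let $M_\ell$ be the $k\times n$ weight matrix with entries $$M_\ell(i,j)=\begin{cases}(i-1)(n-j+1)& i\ne 2,\\ \ell-j+1 & i=2,\ 1\le j\le \ell,\\ n-j+\ell+1& i=2,\ \ell<j\le n,\end{cases}$$ where the weight of a monomial in the $x_{i,j}$ is the sum of the entries of $M_\ell$ corresponding to its variables (with multiplicity). Let $\mathbf w_\ell(P_J)$ be the least weight with respect to $M_\ell$ of a term of $\det(X_J)$, and let $G_{k,n,\ell}=\mathrm{in}_{\mathbf w_\ell}(G_{k,n})$ be the ideal generated by the initial forms (sums of the terms of least $\mathbf w_\ell$-weight) of all elements of $G_{k,n}$. Let $v=(v_1<\dots<v_k)$ be a $k$-subset of $[n]$ (a Grassmannian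 permutation, recorded by its first $k$ entries). For $k$-subsets, $v\le I=\{i_1<\dots<i_k\}$ means $v_a\le i_a$ for all $a$. Put $$G_{k,n,\ell}|^v=\big(G_{k,n,\ell}+\langle P_I : v\not\le I\rangle\big)\cap \mathbb K[P_I : v\le I],$$ an ideal of $\mathbb K[P_I : v\le I]$; it is the ideal attached to the opposite Schubert variety of $v$ in $\mathrm{Gr}(k,n)$. Let $w_0v=\{n+1-v_1,\dots,n+1-v_k\}$ and $$Z_{k,n}=\big\{\{1,\dots,k-1,i\} : k\le i\le n\big\}\cup\big\{\{1,\dots,k+1\}\setminus\{i\} : 1\le i\le k-1\big\}.$$ Theorem. (i) The ideal $G_{k,n,\ell}|^v$ contains a monomial if and only if it is nonzero and all of the following hold: $1\le \ell\le n-k+1$; $v_1\in\{1,\dots,\ell\}$; $k\ge 2$ and $v_2\in\{v_1+2,\dots,n\}\setminus\{\ell+1\}$. (ii) The ideal $G_{k,n,\ell}|^v$ is zero if and only if $w_0v\in Z_{k,n}$. -/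

import Mathlib

open MvPolynomial

noncomputable section

/-- The `k`-subsets `I = {i₁ < ⋯ < i_k}` of `[n]`, written as strictly increasing sequences.
The same data records a Grassmannian permutation by its first `k` entries. Element `a : Fin n`
stands for the integer `a + 1 ∈ [n]`; the integer itself is `entry I a`. -/
abbrev KSubset (k n : ℕ) : Type := Fin k ↪o Fin n

namespace KSubset

variable {k n : ℕ}

/-- The entry of `I` in position `a`, as an integer in `{1, …, n}`. -/
def entry (I : KSubset k n) (a : Fin k) : ℕ := (I a : ℕ) + 1

/-- The underlying subset of `{1, …, n}`. -/
def toFinset (I : KSubset k n) : Finset ℕ := Finset.univ.image I.entry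

/-- The componentwise comparison of `k`-subsets: `v_a ≤ i_a` for all `a`. -/
def Below (v I : KSubset k n) : Prop := ∀ a, v.entry a ≤ I.entry a

/-- The action of the longest permutation `w₀`: replace every element `i` by `n + 1 - i`
(and list the result increasingly). -/
def w0 (v : KSubset k n) : KSubset k n :=
  OrderEmbedding.ofStrictMono (fun a => Fin.rev (v (Fin.rev a))) (by
    intro a b hab
    exact Fin.rev_lt_rev.mpr (v.strictMono (Fin.rev_lt_rev.mpr hab)))

theorem w0_apply (v : KSubset k n) (a : Fin k) : w0 v a = Fin.rev (v (Fin.rev a)) := rfl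

/-- `w₀ v` is indeed obtained from `v` by applying `i ↦ n + 1 - i` to every element. -/
theorem toFinset_w0 (v : KSubset k n) :
    (w0 v).toFinset = v.toFinset.image (fun i => n + 1 - i) := by
  ext x
  simp only [toFinset, entry, w0_apply, Finset.mem_image, Finset.mem_univ, true_and,
    Fin.val_rev, exists_exists_eq_and]
  constructor
  · rintro ⟨a, rfl⟩
    refine ⟨Fin.rev a, ?_⟩
    have := (v (Fin.rev a)).isLt
    omega
  · rintro ⟨a, rfl⟩
    refine ⟨Fin.rev a, ?_⟩
    have := (v a).isLt
    rw [Fin.rev_rev]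
    omega

end KSubset

/-- The set `Z_{k,n}` of the sets `{1, …, k-1, i}` with `k ≤ i ≤ n` and the sets
`{1, …, k+1} \ {i}` with `1 ≤ i ≤ k - 1`. -/
def Zset (k n : ℕ) : Set (Finset ℕ) :=
  {A | ∃ i, k ≤ i ∧ i ≤ n ∧ A = insert i (Finset.Icc 1 (k - 1))} ∪
  {A | ∃ i, 1 ≤ i ∧ i ≤ k - 1 ∧ A = (Finset.Icc 1 (k + 1)).erase i}

/-- The `k × n` weight matrix `M_ℓ`. With the integer indices `i = p.1 + 1`, `j = p.2 + 1` its
entries are `(i-1)(n-j+1)` for `i ≠ 2`, and for `i = 2` they are `ℓ-j+1` if `j ≤ ℓ` and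
`n-j+ℓ+1` if `j > ℓ`. No subtraction truncates. -/
def weightMatrix (k n l : ℕ) (p : Fin k × Fin n) : ℕ :=
  let i := (p.1 : ℕ) + 1
  let j := (p.2 : ℕ) + 1
  if i ≠ 2 then (i - 1) * (n + 1 - j)
  else if j ≤ l then l + 1 - j
  else n + l + 1 - j

section Ideals

variable (K : Type*) [Field K]

/-- The least weight of a monomial occurring in `f` (and `0` if `f = 0`). -/
def minWeight {σ : Type*} (w : σ → ℕ) (f : MvPolynomial σ K) : ℕ :=
  sInf ((fun m => Finsupp.weight w m) '' (f.support : Set (σ →₀ ℕ)))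

/-- The initial form `in_w(f)`: the sum of the terms of `f` of least weight. -/
def initialForm {σ : Type*} (w : σ → ℕ) (f : MvPolynomial σ K) : MvPolynomial σ K :=
  weightedHomogeneousComponent w (minWeight K w f) f

/-- The initial ideal `in_w(I)`, generated by the initial forms of all elements of `I`. -/
def initialIdeal {σ : Type*} (w : σ → ℕ) (I : Ideal (MvPolynomial σ K)) :
    Ideal (MvPolynomial σ K) :=
  Ideal.span (initialForm K w '' (I : Set (MvPolynomial σ K)))

/-- The Plücker form of `J`: the maximal minor of the generic `k × n` matrix with columns `J`. -/
def pluckerForm (k n : ℕ) (J : KSubset k n) : MvPolynomial (Fin k × Fin n) K :=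
  (Matrix.of fun i j : Fin k => (X (i, J j) : MvPolynomial (Fin k × Fin n) K)).det

/-- The Plücker ideal `G_{k,n}` of `Gr(k,n)`: the kernel of `P_J ↦ pluckerForm J`. -/
def pluckerIdeal (k n : ℕ) : Ideal (MvPolynomial (KSubset k n) K) :=
  RingHom.ker (aeval (R := K) (pluckerForm K k n))

/-- The weight `w_ℓ` on Plücker variables induced by `M_ℓ`: the weight of `P_J` is the weight of
the terms of the initial form of its Plücker form. -/
def pluckerWeight (k n l : ℕ) (J : KSubset k n) : ℕ :=
  minWeight K (weightMatrix k n l) (pluckerForm K k n J)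

/-- The ideal `G_{k,n,ℓ} = in_{w_ℓ}(G_{k,n})`. -/
def matchingFieldIdeal (k n l : ℕ) : Ideal (MvPolynomial (KSubset k n) K) :=
  initialIdeal K (pluckerWeight K k n l) (pluckerIdeal K k n)

/-- For a collection `S` of `k`-subsets with complement `T`, the ideal
`G_{k,n,ℓ}|_S = (G_{k,n,ℓ} + ⟨P_I : I ∈ S⟩) ∩ K[P_I : I ∈ T]` of `K[P_I : I ∈ T]`. -/
def restrictedIdeal (k n l : ℕ) (S : Set (KSubset k n)) :
    Ideal (MvPolynomial {I : KSubset k n // I ∉ S} K) :=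
  (matchingFieldIdeal K k n l ⊔ Ideal.span ((fun I => X I) '' S)).comap
    (rename (R := K) (Subtype.val : {I : KSubset k n // I ∉ S} → KSubset k n))

/-- The collection `S_k^v` of the `k`-subsets `I` with `v ≰ I`; these index the Plücker variables
that vanish on the opposite Schubert variety of `v`. -/
def oppositeVanishing {k n : ℕ} (v : KSubset k n) : Set (KSubset k n) := {I | ¬ v.Below I}

/-- The ideal `G_{k,n,ℓ}|^v` attached to the opposite Schubert variety of `v` in `Gr(k,n)`. -/
def oppositeIdeal {k n : ℕ} (l : ℕ) (v : KSubset k n) :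
    Ideal (MvPolynomial {I : KSubset k n // I ∉ oppositeVanishing v} K) :=
  restrictedIdeal K k n l (oppositeVanishing v)

variable {K}

/-- The ideal `I` contains a monomial. -/
def ContainsMonomial {σ : Type*} (I : Ideal (MvPolynomial σ K)) : Prop :=
  ∃ m : σ →₀ ℕ, monomial m (1 : K) ∈ I

end Ideals

end

/-! Count elements from zero and let `v₀ < v₁` be the two smallest elements of `v`. From the third
row on, each row of `M_ℓ` is steeper than those above it. Hence the lightest term of a minor is the
diagonal one, or the diagonal one with its first two columns exchanged when the jump of the second
row lies between them (`permWeight_matchingPerm_lt`). Degenerating along the curve `x t^M` shows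
that the lightest terms, evaluated at any matrix `x`, form a zero of the initial ideal
(`aeval_initialValue_eq_zero`).

Such zeros give the negative statements. A 0/1 matrix whose nonzero coordinates are exactly the `I ≥
v` excludes monomials, and one exists whenever a listed condition on `ℓ`, `v₀`, `v₁` fails
(`not_containsMonomial_of_pair_thresholds`). A matrix with all rows equal to a vector of
indeterminates shows that a monomial determined by its content has coefficient zero throughout the
initial ideal (`coeff_eq_zero_of_content_unique`); when `w₀v ∈ Z_{k,n}`, every monomial in the
surviving variables is of this kind.

Three-term Plücker relations give the positive statements, on sets `{x, y}` completed by the `k - 2`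
largest elements. On the elements `n-k-2, …, n-k+1` they yield a nonzero element
(`oppositeIdeal_ne_bot`). On `v₀, v₁-1, v₁, n-k+1` the initial form is a binomial with one term
killed by the restriction, which leaves a monomial (`containsMonomial_oppositeIdeal`). -/

/-- The permutation `σ` sending the position of each element of `J` to the row of the matrix in
which it occurs in the term of least weight of the maximal minor with columns `J`. -/
def matchingPerm {k n : ℕ} (l : ℕ) (J : KSubset k n) : Equiv.Perm (Fin k) :=
  if h : ∃ h2 : 2 ≤ k, (J ⟨0, by omega⟩ : ℕ) < l ∧ l ≤ (J ⟨1, h2⟩ : ℕ) then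
    Equiv.swap ⟨0, by have := h.1; omega⟩ ⟨1, h.1⟩
  else 1

/-- The weight of the term of the maximal minor with columns `J` indexed by `σ`. -/
def permWeight {k n : ℕ} (l : ℕ) (J : KSubset k n) (σ : Equiv.Perm (Fin k)) : ℕ :=
  ∑ i, weightMatrix k n l (σ i, J i)

/-- The second row of the weight matrix, with zero-based column index. -/
def secondRow (n l j : ℕ) : ℕ := if j < l then l - j else n + l - j

/-! ### The unique lightest term of a maximal minor. -/

section Weights

variable {k n l : ℕ}

theorem weightMatrix_of_ne_one {i : Fin k} (hi : (i : ℕ) ≠ 1) (j : Fin n) :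
    weightMatrix k n l (i, j) = i * (n - j) := by
  simp [weightMatrix, hi]

theorem weightMatrix_of_eq_one {i : Fin k} (hi : (i : ℕ) = 1) (j : Fin n) :
    weightMatrix k n l (i, j) = secondRow n l j := by
  simp only [weightMatrix, hi, secondRow]
  have := j.isLt
  split_ifs <;> omega

theorem permWeight_mul_swap_lt {J : KSubset k n} {σ : Equiv.Perm (Fin k)} {a b : Fin k}
    (hab : a ≠ b)
    (h : weightMatrix k n l (σ b, J a) + weightMatrix k n l (σ a, J b) <
      weightMatrix k n l (σ a, J a) + weightMatrix k n l (σ b, J b)) :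
    permWeight l J (σ * Equiv.swap a b) < permWeight l J σ := by
  have split : ∀ f : Fin k → ℕ, ∑ i, f i = f a + (f b + ∑ i ∈ (Finset.univ.erase a).erase b, f i) := by
    intro f
    rw [Finset.add_sum_erase _ f (by simp [hab.symm]), Finset.add_sum_erase _ f (by simp)]
  have hrest : ∑ i ∈ (Finset.univ.erase a).erase b,
      weightMatrix k n l ((σ * Equiv.swap a b) i, J i) =
      ∑ i ∈ (Finset.univ.erase a).erase b, weightMatrix k n l (σ i, J i) := by
    refine Finset.sum_congr rfl fun i hi => ?_
    simp only [Finset.mem_erase, Finset.mem_univ, and_true] at hi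
    rw [Equiv.Perm.mul_apply, Equiv.swap_apply_of_ne_of_ne hi.2 hi.1]
  simp only [permWeight]
  rw [split, split (fun i => weightMatrix k n l (σ i, J i)), hrest]
  simp only [Equiv.Perm.mul_apply, Equiv.swap_apply_left, Equiv.swap_apply_right]
  omega

/-- From column `x` to column `y`, row `r` falls by `r (y - x)` and row `s` by at most `s (y - x)`:
the second row has slope one and its only jump is upward. -/
theorem weightMatrix_exchange {r s : Fin k} (hsr : s < r) (hr : 2 ≤ (r : ℕ))
    {x y : Fin n} (hxy : x < y) :
    weightMatrix k n l (s, x) + weightMatrix k n l (r, y) <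
      weightMatrix k n l (r, x) + weightMatrix k n l (s, y) := by
  obtain ⟨x, hx⟩ := x
  obtain ⟨y, hy⟩ := y
  obtain ⟨s, hs⟩ := s
  obtain ⟨r, hr'⟩ := r
  simp only [Fin.mk_lt_mk] at *
  have key : r * (n - x) = r * (n - y) + r * (y - x) := by
    rw [← Nat.mul_add]; congr 1; omega
  rw [weightMatrix_of_ne_one (i := ⟨r, hr'⟩) (by simp; omega),
    weightMatrix_of_ne_one (i := ⟨r, hr'⟩) (by simp; omega)]
  by_cases h1 : s = 1
  · rw [weightMatrix_of_eq_one (by simpa using h1), weightMatrix_of_eq_one (by simpa using h1)]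
    have : 2 * (y - x) ≤ r * (y - x) := Nat.mul_le_mul_right _ hr
    simp only [secondRow]
    split_ifs <;> omega
  · rw [weightMatrix_of_ne_one (by simpa using h1), weightMatrix_of_ne_one (by simpa using h1)]
    have key' : s * (n - x) = s * (n - y) + s * (y - x) := by
      rw [← Nat.mul_add]; congr 1; omega
    have : s * (y - x) < r * (y - x) := Nat.mul_lt_mul_of_pos_right hsr (by omega)
    simp only
    omega

theorem perm_eq_one_of_strictMono {σ : Equiv.Perm (Fin k)} (h : StrictMono σ) : σ = 1 := by
  have : OrderEmbedding.ofStrictMono σ h = OrderEmbedding.ofStrictMono id strictMono_id := by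
    rw [← OrderEmbedding.range_inj]
    ext x
    simp
  ext i
  simpa using congrArg (fun f => ((f i : Fin k) : ℕ)) this

/-- A permutation of `Fin k` whose inversions all involve only the two smallest values is trivial
or exchanges the first two elements. -/
theorem perm_eq_one_or_swap (h2 : 2 ≤ k) {σ : Equiv.Perm (Fin k)}
    (h : ∀ a b, a < b → σ b < σ a → (σ a : ℕ) < 2) :
    σ = 1 ∨ σ = Equiv.swap ⟨0, by omega⟩ ⟨1, h2⟩ := by
  by_cases hm : StrictMono σ
  · exact Or.inl (perm_eq_one_of_strictMono hm)
  right
  set z : Fin k := ⟨0, by omega⟩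
  set o : Fin k := ⟨1, h2⟩
  have inv : ∀ a b, a < b → σ b < σ a → σ a = o ∧ σ b = z := by
    intro a b hab hs
    have := h a b hab hs
    rw [Fin.lt_def] at hs
    constructor <;> ext <;> simp only [z, o] <;> omega
  obtain ⟨a, b, hab, hs⟩ : ∃ a b, a < b ∧ σ b < σ a := by
    by_contra! hcon
    exact hm fun a b hab => lt_of_le_of_ne (hcon a b hab) (fun e => hab.ne (σ.injective e))
  obtain ⟨ha, hb⟩ := inv a b hab hs
  -- Exchanging the values `z` and `o` affects only their own relative order, and every inversion of
  -- `σ` is between these two values.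
  have hρ : StrictMono (Equiv.swap z o * σ) := by
    intro c d hcd
    simp only [Equiv.Perm.mul_apply]
    rcases lt_or_ge (σ d) (σ c) with hlt | hle
    · obtain ⟨hc, hd⟩ := inv c d hcd hlt
      rw [hc, hd, Equiv.swap_apply_left, Equiv.swap_apply_right]
      simp [z, o]
    · have hlt : σ c < σ d := lt_of_le_of_ne hle (fun e => hcd.ne (σ.injective e))
      have hnot : ¬ (σ c = z ∧ σ d = o) := by
        rintro ⟨hc, hd⟩
        have h1 : c = b := σ.injective (hc.trans hb.symm)
        have h2 : d = a := σ.injective (hd.trans ha.symm)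
        subst h1 h2
        exact absurd hcd hab.asymm
      rw [Equiv.swap_apply_def, Equiv.swap_apply_def]
      simp only [Fin.ext_iff, Fin.lt_def, z, o] at *
      split_ifs <;> simp_all <;> omega
  have h1 := perm_eq_one_of_strictMono hρ
  calc σ = Equiv.swap z o * (Equiv.swap z o * σ) := by rw [← mul_assoc, Equiv.swap_mul_self, one_mul]
    _ = Equiv.swap z o := by rw [h1, mul_one]

theorem matchingPerm_eq_swap (h2 : 2 ≤ k) {J : KSubset k n} (h0 : (J ⟨0, by omega⟩ : ℕ) < l)
    (h1 : l ≤ (J ⟨1, h2⟩ : ℕ)) :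
    matchingPerm l J = Equiv.swap ⟨0, by omega⟩ ⟨1, h2⟩ :=
  dif_pos ⟨h2, h0, h1⟩

theorem matchingPerm_eq_one {J : KSubset k n}
    (h : ¬ ∃ h2 : 2 ≤ k, (J ⟨0, by omega⟩ : ℕ) < l ∧ l ≤ (J ⟨1, h2⟩ : ℕ)) :
    matchingPerm l J = 1 :=
  dif_neg h

/-- If no transposition lowers the weight, `weightMatrix_exchange` confines inversions to the first
two rows. The first row is zero, so the second-row entries in the two smallest columns decide
between the two remaining permutations. -/
theorem exists_permWeight_lt (J : KSubset k n) {σ : Equiv.Perm (Fin k)}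
    (hσ : σ ≠ matchingPerm l J) : ∃ τ, permWeight l J τ < permWeight l J σ := by
  by_contra! hmin
  have hsw : ∀ a b, a < b → ¬ (weightMatrix k n l (σ b, J a) + weightMatrix k n l (σ a, J b) <
      weightMatrix k n l (σ a, J a) + weightMatrix k n l (σ b, J b)) := fun a b hab h =>
    absurd (hmin _) (not_le.mpr (permWeight_mul_swap_lt hab.ne h))
  rcases Nat.lt_or_ge k 2 with hk | hk
  · have : Subsingleton (Fin k) := by
      exact Fin.subsingleton_iff_le_one.mpr (by omega)
    exact hσ (Subsingleton.elim _ _)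
  have h01 : (⟨0, by omega⟩ : Fin k) < ⟨1, hk⟩ := by simp
  have hJ : (J ⟨0, by omega⟩ : ℕ) < J ⟨1, hk⟩ := J.strictMono h01
  have hJn := (J ⟨1, hk⟩).isLt
  have key := hsw _ _ h01
  rcases perm_eq_one_or_swap hk (σ := σ) (fun a b hab hs => by
      by_contra! h2
      exact hsw a b hab (weightMatrix_exchange hs h2 (J.strictMono hab))) with h1 | h1
  · subst h1
    simp only [Equiv.Perm.one_apply] at key
    rw [weightMatrix_of_eq_one (i := ⟨1, hk⟩) rfl, weightMatrix_of_eq_one (i := ⟨1, hk⟩) rfl,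
      weightMatrix_of_ne_one (by simp), weightMatrix_of_ne_one (by simp)] at key
    refine hσ (matchingPerm_eq_one ?_).symm
    rintro ⟨_, h3, h4⟩
    apply key
    simp only [secondRow, h3, if_true, if_neg (not_lt.mpr h4)]
    omega
  · subst h1
    rw [Equiv.swap_apply_left, Equiv.swap_apply_right, 
      weightMatrix_of_eq_one (i := ⟨1, hk⟩) rfl, weightMatrix_of_eq_one (i := ⟨1, hk⟩) rfl,
      weightMatrix_of_ne_one (by simp), weightMatrix_of_ne_one (by simp)] at key
    simp only [secondRow] at key
    refine hσ (matchingPerm_eq_swap hk ?_ ?_).symm <;> split_ifs at key <;> omega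

/-- The term indexed by `matchingPerm l J` is the unique term of least weight. -/
theorem permWeight_matchingPerm_lt (J : KSubset k n) {σ : Equiv.Perm (Fin k)}
    (hσ : σ ≠ matchingPerm l J) : permWeight l J (matchingPerm l J) < permWeight l J σ := by
  obtain ⟨τ, hτ⟩ := Finite.exists_min (permWeight l J)
  have : τ = matchingPerm l J := by
    by_contra hne
    obtain ⟨ρ, hρ⟩ := exists_permWeight_lt J hne
    exact absurd (hτ ρ) (not_le.mpr hρ)
  subst this
  obtain ⟨ρ, hρ⟩ := exists_permWeight_lt J hσ
  exact (hτ ρ).trans_lt hρ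

theorem permWeight_matchingPerm_le (J : KSubset k n) (σ : Equiv.Perm (Fin k)) :
    permWeight l J (matchingPerm l J) ≤ permWeight l J σ := by
  by_cases h : σ = matchingPerm l J
  · rw [h]
  · exact (permWeight_matchingPerm_lt J h).le

variable (K : Type*) [Field K]

theorem minWeight_eq {σ : Type*} {w : σ → ℕ} {f : MvPolynomial σ K} {W : ℕ}
    (hle : ∀ d ∈ f.support, W ≤ Finsupp.weight w d)
    (hex : ∃ d ∈ f.support, Finsupp.weight w d = W) : minWeight K w f = W := by
  obtain ⟨d, hd, hW⟩ := hex
  apply le_antisymm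
  · exact Nat.sInf_le ⟨d, hd, hW⟩
  · refine le_csInf ⟨W, d, hd, hW⟩ ?_
    rintro _ ⟨e, he, rfl⟩
    exact hle e he

theorem minWeight_le {σ : Type*} {w : σ → ℕ} {f : MvPolynomial σ K} {d : σ →₀ ℕ}
    (hd : d ∈ f.support) : minWeight K w f ≤ Finsupp.weight w d :=
  Nat.sInf_le ⟨d, hd, rfl⟩

theorem pluckerForm_eq_sum (J : KSubset k n) :
    pluckerForm K k n J = ∑ σ : Equiv.Perm (Fin k),
      monomial (∑ i, Finsupp.single (σ i, J i) 1) ((Equiv.Perm.sign σ : ℤ) : K) := by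
  rw [pluckerForm, Matrix.det_apply]
  refine Finset.sum_congr rfl fun σ _ => ?_
  have h : (∏ i, (Matrix.of fun i j : Fin k => (X (i, J j) : MvPolynomial (Fin k × Fin n) K)) (σ i) i)
      = monomial (∑ i, Finsupp.single (σ i, J i) 1) 1 := by
    rw [monomial_sum_one]
    rfl
  rw [h, Units.smul_def, zsmul_eq_mul, ← map_intCast (C : K →+* MvPolynomial (Fin k × Fin n) K),
    C_mul_monomial, mul_one]

theorem weight_sum_single (J : KSubset k n) (σ : Equiv.Perm (Fin k)) :
    Finsupp.weight (weightMatrix k n l) (∑ i, Finsupp.single (σ i, J i) 1) = permWeight l J σ := by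
  simp [permWeight, map_sum, Finsupp.weight_single]

theorem pluckerWeight_eq (J : KSubset k n) :
    pluckerWeight K k n l J = permWeight l J (matchingPerm l J) := by
  apply minWeight_eq
  · intro d hd
    rw [pluckerForm_eq_sum] at hd
    obtain ⟨σ, -, hσ⟩ := Finset.mem_biUnion.mp (support_sum hd)
    have := Finset.mem_singleton.mp (Finsupp.support_single_subset hσ)
    rw [this, weight_sum_single]
    exact permWeight_matchingPerm_le J σ
  · refine ⟨∑ i, Finsupp.single (matchingPerm l J i, J i) 1, ?_, weight_sum_single J _⟩
    rw [mem_support_iff, pluckerForm_eq_sum, coeff_sum,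
      Finset.sum_eq_single_of_mem (matchingPerm l J) (Finset.mem_univ _)]
    · rw [coeff_monomial, if_pos rfl]
      rcases Int.units_eq_one_or (Equiv.Perm.sign (matchingPerm l J)) with h | h <;> simp [h]
    · intro σ _ hσ
      rw [coeff_monomial, if_neg]
      intro he
      have := congrArg (Finsupp.weight (weightMatrix k n l)) he
      rw [weight_sum_single, weight_sum_single] at this
      exact (permWeight_matchingPerm_lt J hσ).ne' this

end Weights

/-! ### Zeros of the initial ideal obtained by degeneration. -/

section InitialPoints

variable {k n l : ℕ} {K : Type*} [Field K] {R : Type*} [CommRing R] [Algebra K R]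

/-- The value at `x` of the term of least weight of the maximal minor with columns `J`. -/
def initialValue (l : ℕ) (x : Fin k × Fin n → R) (J : KSubset k n) : R :=
  ((Equiv.Perm.sign (matchingPerm l J) : ℤ) : R) * ∏ i, x (matchingPerm l J i, J i)

/-- The maximal minor with columns `J` at the curve `t ↦ x t^M`, divided by its lowest power
of `t`. -/
noncomputable def minorCurve (l : ℕ) (x : Fin k × Fin n → R) (J : KSubset k n) : Polynomial R :=
  ∑ σ : Equiv.Perm (Fin k),
    Polynomial.X ^ (permWeight l J σ - permWeight l J (matchingPerm l J)) *
      Polynomial.C (((Equiv.Perm.sign σ : ℤ) : R) * ∏ i, x (σ i, J i))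

theorem coeff_zero_minorCurve (x : Fin k × Fin n → R) (J : KSubset k n) :
    (minorCurve l x J).coeff 0 = initialValue l x J := by
  rw [minorCurve, Polynomial.finsetSum_coeff,
    Finset.sum_eq_single_of_mem (matchingPerm l J) (Finset.mem_univ _)]
  · rw [Nat.sub_self, pow_zero, one_mul, Polynomial.coeff_C_zero, initialValue]
  · intro σ _ hσ
    have := permWeight_matchingPerm_lt J hσ
    rw [Polynomial.coeff_X_pow_mul', if_neg (by omega)]

theorem aeval_pluckerForm_curve (x : Fin k × Fin n → R) (J : KSubset k n) :
    aeval (fun p => Polynomial.X ^ weightMatrix k n l p * Polynomial.C (x p)) (pluckerForm K k n J)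
      = Polynomial.X ^ pluckerWeight K k n l J * minorCurve l x J := by
  rw [pluckerForm_eq_sum, map_sum, minorCurve, Finset.mul_sum]
  refine Finset.sum_congr rfl fun σ _ => ?_
  rw [pluckerWeight_eq, ← mul_assoc, ← pow_add,
    Nat.add_sub_cancel' (permWeight_matchingPerm_le J σ), ← mul_one (((_ : ℤ) : K)),
    ← smul_eq_mul, ← smul_monomial, map_smul, monomial_sum_one, map_prod]
  have h : ∀ i, aeval (R := K)
      (fun p => Polynomial.X ^ weightMatrix k n l p * Polynomial.C (x p))
      (monomial (Finsupp.single (σ i, J i) 1) (1 : K)) =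
      Polynomial.X ^ weightMatrix k n l (σ i, J i) * Polynomial.C (x (σ i, J i)) := fun i =>
    aeval_X _ _
  simp only [h, Finset.prod_mul_distrib, Finset.prod_pow_eq_pow_sum, map_mul, map_prod, permWeight,
    Algebra.smul_def, map_intCast]
  ring

/-- Points with initial Plücker coordinates are zeros of the initial ideal. -/
theorem aeval_initialValue_eq_zero (x : Fin k × Fin n → R)
    {g : MvPolynomial (KSubset k n) K} (hg : g ∈ matchingFieldIdeal K k n l) :
    aeval (initialValue l x) g = 0 := by
  suffices h : matchingFieldIdeal K k n l ≤ RingHom.ker (aeval (R := K) (initialValue l x)) from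
    h hg
  refine Ideal.span_le.mpr ?_
  rintro _ ⟨f, hf, rfl⟩
  rw [SetLike.mem_coe, RingHom.mem_ker]
  set w := pluckerWeight K k n l
  set W := minWeight K w f
  -- `f` vanishes at the minors of the curve. Each minor is a power of `t` times a polynomial with
  -- constant term `initialValue`, so the coefficient of `t^W` is the value of the initial form.
  have hf0 : aeval (fun J => Polynomial.X ^ w J * minorCurve l x J) f = 0 := by
    have h1 : aeval (pluckerForm K k n) f = 0 := hf
    have h2 := congrArg
      (aeval fun p => Polynomial.X ^ weightMatrix k n l p * Polynomial.C (x p)) h1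
    rw [map_zero, ← AlgHom.comp_apply, comp_aeval] at h2
    simpa only [aeval_pluckerForm_curve] using h2
  have hterm : ∀ (d : KSubset k n →₀ ℕ) (c : K),
      aeval (fun J => Polynomial.X ^ w J * minorCurve l x J) (monomial d c) =
      Polynomial.X ^ Finsupp.weight w d * aeval (minorCurve l x) (monomial d c) := by
    intro d c
    rw [aeval_monomial, aeval_monomial, Finsupp.weight_apply]
    simp only [mul_pow, Finsupp.prod, Finsupp.sum, ← pow_mul,
      Finset.prod_pow_eq_pow_sum, smul_eq_mul, Finset.prod_mul_distrib, mul_comm (w _)]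
    ring
  have hev : ∀ p : MvPolynomial (KSubset k n) K,
      (aeval (minorCurve l x) p).coeff 0 = aeval (initialValue l x) p := by
    intro p
    have h : ((Polynomial.aeval (0 : R)).restrictScalars K).comp (aeval (minorCurve l x)) =
        aeval (R := K) (initialValue l x) := by
      rw [comp_aeval]
      congr 1
      ext J
      simp [← coeff_zero_minorCurve, Polynomial.coeff_zero_eq_eval_zero]
    rw [← h]
    simp [Polynomial.coeff_zero_eq_eval_zero]
  have hW := congrArg (fun p => Polynomial.coeff p W) hf0
  rw [f.as_sum, map_sum] at hW
  simp only [hterm, Polynomial.finsetSum_coeff, Polynomial.coeff_zero] at hW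
  rw [initialForm, weightedHomogeneousComponent_apply, map_sum, Finset.sum_filter]
  refine Eq.trans (Finset.sum_congr rfl fun d hd => ?_) hW
  have hle : W ≤ Finsupp.weight w d := minWeight_le K hd
  rw [Polynomial.coeff_X_pow_mul']
  change (if Finsupp.weight w d = W then _ else _) = _
  by_cases h : Finsupp.weight w d = W
  · rw [if_pos h, if_pos h.le, h, Nat.sub_self, hev]
  · rw [if_neg h, if_neg (by omega)]

end InitialPoints

/-! ### Three-term relations, their initial forms, and pairs. -/

section ThreeTerm

open scoped Matrix

/-- The three-term Plücker relation between maximal minors that share all columns but two. -/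
theorem Matrix.det_three_term {ι R : Type*} [Fintype ι] [DecidableEq ι] [CommRing R]
    (A : Matrix ι ι R) {p q : ι} (hpq : p ≠ q) (a b c d : ι → R) :
    ((A.updateCol p a).updateCol q c).det * ((A.updateCol p b).updateCol q d).det =
      ((A.updateCol p a).updateCol q b).det * ((A.updateCol p c).updateCol q d).det +
      ((A.updateCol p a).updateCol q d).det * ((A.updateCol p b).updateCol q c).det := by
  set M := (A.updateCol p a).updateCol q b
  have hswap : ∀ x y : ι → R, (A.updateCol q y).updateCol p x = (A.updateCol p x).updateCol q y :=
    fun x y => Matrix.updateCol_comm _ hpq.symm _ _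
  set z := M.cramer c
  have hzp : z p = -((A.updateCol p b).updateCol q c).det := by
    change M.cramer c p = _
    rw [Matrix.cramer_apply]
    have : M.updateCol p c = ((A.updateCol p b).updateCol q c).submatrix id (Equiv.swap p q) := by
      ext i j
      simp only [M, Matrix.updateCol_apply, Matrix.submatrix_apply, id, Equiv.swap_apply_def]
      split_ifs <;> simp_all
    rw [this, Matrix.det_permute']
    simp [Equiv.Perm.sign_swap hpq]
  have hzq : z q = ((A.updateCol p a).updateCol q c).det := by
    change M.cramer c q = _
    rw [Matrix.cramer_apply]
    simp [M]
  -- By Cramer's rule `M z = det M • c`. Both sides are fed to the linear functional sending a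
  -- vector to the determinant of `A` with that vector in column `p` and `d` in column `q`.
  have h := congrArg (fun v => (A.updateCol q d).cramer v p) (M.mulVec_cramer c)
  simp only [Matrix.cramer_apply, hswap] at h
  have hsum : M *ᵥ z = ∑ j, z j • M.col j := by
    ext i
    simp [Matrix.mulVec, dotProduct, Finset.sum_apply, mul_comm]
  rw [show M.mulVec (M.cramer c) = M *ᵥ z from rfl, hsum] at h
  have h2 : ((A.updateCol p (∑ j, z j • M.col j)).updateCol q d).det =
      ∑ j, z j * ((A.updateCol p (M.col j)).updateCol q d).det := by
    simp only [← hswap, ← Matrix.cramer_apply, map_sum, map_smul, Finset.sum_apply, Pi.smul_apply,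
      smul_eq_mul]
  rw [h2, ← Finset.add_sum_erase _ _ (Finset.mem_univ p),
    ← Finset.add_sum_erase _ _ (Finset.mem_erase.mpr ⟨hpq.symm, Finset.mem_univ q⟩),
    Finset.sum_eq_zero] at h
  · have hp : M.col p = a := by ext i; simp [M, hpq]
    have hq : M.col q = b := by ext i; simp [M]
    rw [hp, hq, hzp, hzq, ← hswap (M.det • c), Matrix.det_updateCol_smul, hswap] at h
    linear_combination h
  -- Every other column of `M` already occurs in `A`, so the determinant has a repeated column.
  · intro j hj
    simp only [Finset.mem_erase, Finset.mem_univ, and_true] at hj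
    rw [Matrix.det_zero_of_column_eq hj.2.symm, mul_zero]
    intro i
    simp [M, hj.1, hj.2, hpq]

end ThreeTerm

section InitialForms

variable {K : Type*} [Field K] {σ : Type*} {w : σ → ℕ}

theorem coeff_initialForm (f : MvPolynomial σ K) (d : σ →₀ ℕ) :
    coeff d (initialForm K w f) =
      if Finsupp.weight w d = minWeight K w f then coeff d f else 0 := by
  rw [initialForm, coeff_weightedHomogeneousComponent]

theorem minWeight_trinomial {m₁ m₂ m₃ : σ →₀ ℕ} {c₁ c₂ c₃ : K} (h12 : m₁ ≠ m₂) (h13 : m₁ ≠ m₃)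
    (hc : c₁ ≠ 0) (hw2 : Finsupp.weight w m₁ ≤ Finsupp.weight w m₂)
    (hw3 : Finsupp.weight w m₁ ≤ Finsupp.weight w m₃) :
    minWeight K w (monomial m₁ c₁ + monomial m₂ c₂ + monomial m₃ c₃) = Finsupp.weight w m₁ := by
  classical
  apply minWeight_eq
  · intro d hd
    rw [mem_support_iff] at hd
    simp only [coeff_add, coeff_monomial] at hd
    by_cases e1 : m₁ = d
    · rw [e1]
    by_cases e2 : m₂ = d
    · rw [← e2]; exact hw2
    by_cases e3 : m₃ = d
    · rw [← e3]; exact hw3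
    simp [e1, e2, e3] at hd
  · refine ⟨m₁, ?_, rfl⟩
    rw [mem_support_iff]
    simpa [coeff_monomial, h12.symm, h13.symm] using hc

theorem mem_support_initialForm_trinomial {m₁ m₂ m₃ : σ →₀ ℕ} {c₁ c₂ c₃ : K} (h12 : m₁ ≠ m₂)
    (h13 : m₁ ≠ m₃) (hc : c₁ ≠ 0) (hw2 : Finsupp.weight w m₁ ≤ Finsupp.weight w m₂)
    (hw3 : Finsupp.weight w m₁ ≤ Finsupp.weight w m₃) :
    m₁ ∈ (initialForm K w (monomial m₁ c₁ + monomial m₂ c₂ + monomial m₃ c₃)).support := by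
  classical
  rw [mem_support_iff, coeff_initialForm, minWeight_trinomial h12 h13 hc hw2 hw3, if_pos rfl]
  simpa [coeff_monomial, h12.symm, h13.symm] using hc

theorem initialForm_trinomial {m₁ m₂ m₃ : σ →₀ ℕ} {c₁ c₂ c₃ : K} (h12 : m₁ ≠ m₂)
    (h13 : m₁ ≠ m₃) (hc : c₁ ≠ 0) (hw2 : Finsupp.weight w m₁ = Finsupp.weight w m₂)
    (hw3 : Finsupp.weight w m₁ < Finsupp.weight w m₃) :
    initialForm K w (monomial m₁ c₁ + monomial m₂ c₂ + monomial m₃ c₃) =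
      monomial m₁ c₁ + monomial m₂ c₂ := by
  classical
  ext d
  rw [coeff_initialForm, minWeight_trinomial h12 h13 hc hw2.le hw3.le]
  simp only [coeff_add, coeff_monomial]
  by_cases e1 : m₁ = d
  · subst e1; simp [h13.symm]
  by_cases e2 : m₂ = d
  · subst e2
    simp [hw2.symm, show m₃ ≠ m₂ by rintro rfl; omega]
  by_cases e3 : m₃ = d
  · subst e3; simp [e1, e2, hw3.ne']
  simp [e1, e2, e3]

end InitialForms

section Pairs

variable {k n l : ℕ}

theorem KSubset.add_le_apply (J : KSubset k n) (j : ℕ) :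
    ∀ (i : ℕ) (h : i + j < k), (J ⟨i, by omega⟩ : ℕ) + j ≤ J ⟨i + j, h⟩ := by
  induction j with
  | zero => intro i h; simp
  | succ j ih =>
    intro i h
    have h1 := ih i (by omega)
    have h2 : (J ⟨i + j, by omega⟩ : ℕ) < J ⟨i + (j + 1), h⟩ :=
      J.strictMono (by rw [Fin.lt_def]; simp)
    omega

theorem KSubset.apply_le (J : KSubset k n) (i : Fin k) : (J i : ℕ) ≤ n - k + i := by
  have h := J.add_le_apply (k - 1 - i) i (by omega)
  have h2 := (J ⟨(i : ℕ) + (k - 1 - i), by omega⟩).isLt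
  have : (J ⟨(i : ℕ), i.isLt⟩ : ℕ) = J i := rfl
  omega

theorem KSubset.below_iff (v J : KSubset k n) : v.Below J ↔ ∀ i, (v i : ℕ) ≤ J i := by
  simp [KSubset.Below, KSubset.entry]

/-- With zero-based entries, `J` consists of `x`, `y` and the `k - 2` largest elements. -/
def KSubset.IsPair (J : KSubset k n) (x y : ℕ) : Prop :=
  ∀ i : Fin k, (J i : ℕ) = if (i : ℕ) = 0 then x else if (i : ℕ) = 1 then y else n - k + i

theorem KSubset.exists_isPair (hkn : k ≤ n) {x y : ℕ} (hxy : x < y) (hy : y < n - k + 2) :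
    ∃ J : KSubset k n, J.IsPair x y := by
  have hlt : ∀ i : Fin k,
      (if (i : ℕ) = 0 then x else if (i : ℕ) = 1 then y else n - k + i) < n := by
    intro i
    have := i.isLt
    split_ifs <;> omega
  refine ⟨OrderEmbedding.ofStrictMono (fun i => ⟨_, hlt i⟩) ?_, fun i => rfl⟩
  intro i j hij
  rw [Fin.lt_def] at hij ⊢
  simp only
  split_ifs <;> omega

namespace KSubset.IsPair

variable {J J' : KSubset k n} {x y x' y' : ℕ}

theorem apply_zero (h : J.IsPair x y) (h2 : 2 ≤ k) : (J ⟨0, by omega⟩ : ℕ) = x := by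
  simp [h _]

theorem apply_one (h : J.IsPair x y) (h2 : 2 ≤ k) : (J ⟨1, h2⟩ : ℕ) = y := by
  simp [h _]

theorem ne_of_left (h : J.IsPair x y) (h' : J'.IsPair x' y') (h2 : 2 ≤ k) (hx : x ≠ x') :
    J ≠ J' := by
  rintro rfl
  exact hx ((h.apply_zero h2).symm.trans (h'.apply_zero h2))

theorem ne_of_right (h : J.IsPair x y) (h' : J'.IsPair x' y') (h2 : 2 ≤ k) (hy : y ≠ y') :
    J ≠ J' := by
  rintro rfl
  exact hy ((h.apply_one h2).symm.trans (h'.apply_one h2))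

theorem below_iff (h : J.IsPair x y) (h2 : 2 ≤ k) (v : KSubset k n) :
    v.Below J ↔ (v ⟨0, by omega⟩ : ℕ) ≤ x ∧ (v ⟨1, h2⟩ : ℕ) ≤ y := by
  rw [KSubset.below_iff]
  constructor
  · intro hv
    exact ⟨(hv _).trans (h.apply_zero h2).le, (hv _).trans (h.apply_one h2).le⟩
  · rintro ⟨h0, h1⟩ ⟨i, hi⟩
    rw [h]
    simp only
    split_ifs with e0 e1
    · subst e0; exact h0
    · subst e1; exact h1
    · exact v.apply_le _

/-- One base matrix serves all pairs, as `det_three_term` requires. Its first two columns are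
overwritten, so `c` is constrained only from index 2 on. -/
theorem pluckerForm_eq (h : J.IsPair x y) (h2 : 2 ≤ k) (K : Type*) [Field K] (hx : x < n)
    (hy : y < n) (c : Fin k → Fin n) (hc : ∀ i : Fin k, 2 ≤ (i : ℕ) → (c i : ℕ) = n - k + i) :
    pluckerForm K k n J =
      ((((Matrix.of fun i j => X (i, c j)).updateCol ⟨0, by omega⟩
        fun i => X (i, ⟨x, hx⟩)).updateCol ⟨1, h2⟩ fun i => X (i, ⟨y, hy⟩)).det) := by
  rw [pluckerForm]
  congr 1
  ext1 i j
  simp only [Matrix.of_apply, Matrix.updateCol_apply, Fin.ext_iff]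
  have hj := h j
  split_ifs at hj ⊢ with h0 h1
  · omega
  · congr 2; ext; simpa using hj
  · congr 2; ext; simpa using hj
  · congr 2; ext; rw [hj, hc j (by omega)]

/-- The first row is zero, so the second row takes the cheaper of the two columns. The remaining sum
does not depend on the pair and cancels in comparisons. -/
theorem pluckerWeight_eq (h : J.IsPair x y) (h2 : 2 ≤ k) (K : Type*) [Field K] :
    pluckerWeight K k n l J = min (secondRow n l x) (secondRow n l y) +
      ∑ i ∈ (Finset.univ.erase (⟨0, by omega⟩ : Fin k)).erase ⟨1, h2⟩,
        (i : ℕ) * (n - (n - k + i)) := by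
  have split : ∀ f : Fin k → ℕ, ∑ i, f i = f ⟨0, by omega⟩ + (f ⟨1, h2⟩ +
      ∑ i ∈ (Finset.univ.erase (⟨0, by omega⟩ : Fin k)).erase ⟨1, h2⟩, f i) := by
    intro f
    rw [Finset.add_sum_erase _ f (by simp), Finset.add_sum_erase _ f (by simp)]
  have hrest : ∀ τ : Equiv.Perm (Fin k), (τ = 1 ∨ τ = Equiv.swap ⟨0, by omega⟩ ⟨1, h2⟩) →
      ∑ i ∈ (Finset.univ.erase (⟨0, by omega⟩ : Fin k)).erase ⟨1, h2⟩,
        weightMatrix k n l (τ i, J i) =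
      ∑ i ∈ (Finset.univ.erase (⟨0, by omega⟩ : Fin k)).erase ⟨1, h2⟩,
        (i : ℕ) * (n - (n - k + i)) := by
    intro τ hτ
    refine Finset.sum_congr rfl fun i hi => ?_
    simp only [Finset.mem_erase, Finset.mem_univ, and_true] at hi
    have hτi : τ i = i := by
      rcases hτ with rfl | rfl
      · rfl
      · exact Equiv.swap_apply_of_ne_of_ne hi.2 hi.1
    have hi' := hi
    simp only [Fin.ext_iff, ne_eq] at hi'
    rw [hτi, weightMatrix_of_ne_one hi'.1, h i, if_neg hi'.2, if_neg hi'.1]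
  have h0 := h.apply_zero h2
  have h1 := h.apply_one h2
  have hlt : (J ⟨0, by omega⟩ : ℕ) < J ⟨1, h2⟩ := J.strictMono (by simp)
  have hy := (J ⟨1, h2⟩).isLt
  rw [_root_.pluckerWeight_eq, permWeight, split]
  by_cases hsw : x < l ∧ l ≤ y
  · rw [matchingPerm_eq_swap h2 (by omega) (by omega), hrest _ (Or.inr rfl),
      Equiv.swap_apply_left, Equiv.swap_apply_right, weightMatrix_of_eq_one (i := ⟨1, h2⟩) rfl,
      weightMatrix_of_ne_one (by simp), h0, Nat.zero_mul, Nat.zero_add, min_eq_left]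
    simp only [secondRow]
    split_ifs <;> omega
  · rw [matchingPerm_eq_one (by rintro ⟨_, h3, h4⟩; omega), hrest _ (Or.inl rfl)]
    simp only [Equiv.Perm.one_apply]
    rw [weightMatrix_of_eq_one (i := ⟨1, h2⟩) rfl,
      weightMatrix_of_ne_one (by simp), h1, Nat.zero_mul, Nat.zero_add, min_eq_right]
    simp only [secondRow]
    split_ifs <;> omega

end KSubset.IsPair

variable (K : Type*) [Field K]

/-- The three-term Plücker relations, for pairs completed by the `k - 2` largest elements. -/
theorem threeTerm_mem_pluckerIdeal (h2 : 2 ≤ k) (hkn : k ≤ n) {a b c d : ℕ}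
    {ab ac ad bc bd cd : KSubset k n} (hab : ab.IsPair a b) (hac : ac.IsPair a c)
    (had : ad.IsPair a d) (hbc : bc.IsPair b c) (hbd : bd.IsPair b d) (hcd : cd.IsPair c d) :
    (monomial (Finsupp.single ac 1 + Finsupp.single bd 1) 1 +
      monomial (Finsupp.single ab 1 + Finsupp.single cd 1) (-1) +
      monomial (Finsupp.single ad 1 + Finsupp.single bc 1) (-1) :
        MvPolynomial (KSubset k n) K) ∈ pluckerIdeal K k n := by
  have ha : a < n := (hab.apply_zero h2) ▸ (ab _).isLt
  have hb : b < n := (hab.apply_one h2) ▸ (ab _).isLt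
  have hc : c < n := (hac.apply_one h2) ▸ (ac _).isLt
  have hd : d < n := (had.apply_one h2) ▸ (ad _).isLt
  have hcol : ∀ i : Fin k, 2 ≤ (i : ℕ) →
      (((fun i => ⟨n - k + i, by omega⟩) : Fin k → Fin n) i : ℕ) = n - k + i := fun _ _ => rfl
  rw [pluckerIdeal, RingHom.mem_ker]
  have hm : ∀ (p q : KSubset k n) (e : K), aeval (pluckerForm K k n)
      (monomial (Finsupp.single p 1 + Finsupp.single q 1) e) =
      C e * (pluckerForm K k n p * pluckerForm K k n q) := by
    intro p q e
    have : (monomial (Finsupp.single p 1 + Finsupp.single q 1) e : MvPolynomial (KSubset k n) K) =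
        C e * (X p * X q) := by
      rw [X, X, monomial_mul, C_mul_monomial, mul_one, mul_one]
    rw [this, map_mul, map_mul, aeval_X, aeval_X, algHom_C, algebraMap_eq]
  simp only [map_add, hm]
  rw [hab.pluckerForm_eq h2 K ha hb _ hcol, hac.pluckerForm_eq h2 K ha hc _ hcol,
    had.pluckerForm_eq h2 K ha hd _ hcol, hbc.pluckerForm_eq h2 K hb hc _ hcol,
    hbd.pluckerForm_eq h2 K hb hd _ hcol, hcd.pluckerForm_eq h2 K hc hd _ hcol,
    Matrix.det_three_term _ (by simp)]
  simp only [map_neg, map_one]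
  ring

end Pairs

/-! ### Criteria for having no monomial and for being nonzero. -/

section Restriction

variable {k n l : ℕ} {K : Type*} [Field K]

theorem not_containsMonomial_of_initialValue {S : Set (KSubset k n)} (x : Fin k × Fin n → K)
    (hS : ∀ I ∈ S, initialValue l x I = 0) (hT : ∀ I ∉ S, initialValue l x I ≠ 0) :
    ¬ ContainsMonomial (restrictedIdeal K k n l S) := by
  rintro ⟨m, hm⟩
  have hle : matchingFieldIdeal K k n l ⊔ Ideal.span ((fun I => X I) '' S) ≤
      RingHom.ker (aeval (R := K) (initialValue l x)) := by
    refine sup_le (fun g hg => aeval_initialValue_eq_zero x hg) (Ideal.span_le.mpr ?_)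
    rintro _ ⟨I, hI, rfl⟩
    simpa [RingHom.mem_ker] using hS I hI
  have h : aeval (initialValue l x) (rename Subtype.val (monomial m (1 : K))) = 0 := hle hm
  rw [aeval_rename, aeval_monomial, map_one, one_mul, Finsupp.prod, Finset.prod_eq_zero_iff] at h
  obtain ⟨I, -, hI⟩ := h
  exact hT I.1 I.2 (eq_zero_of_pow_eq_zero hI)

/-- Row `i` of the test matrix is 1 from column `u i` on and 0 before it, so the lightest term of a
minor is `±1` if all thresholds are met and 0 otherwise. -/
theorem not_containsMonomial_of_thresholds {v : KSubset k n} (u : Fin k → ℕ)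
    (hu : ∀ I : KSubset k n, (∀ i, u (matchingPerm l I i) ≤ I i) ↔ v.Below I) :
    ¬ ContainsMonomial (oppositeIdeal K l v) := by
  classical
  have key : ∀ I : KSubset k n,
      initialValue (R := K) l (fun p => if u p.1 ≤ p.2 then 1 else 0) I ≠ 0 ↔ v.Below I := by
    intro I
    rw [← hu, initialValue]
    rcases Int.units_eq_one_or (Equiv.Perm.sign (matchingPerm l I)) with h | h <;>
      simp [h, Finset.prod_ne_zero_iff]
  refine not_containsMonomial_of_initialValue (fun p => if u p.1 ≤ p.2 then 1 else 0)
    (fun I hI => ?_) (fun I hI => ?_)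
  · by_contra h
    exact hI ((key I).mp h)
  · exact (key I).mpr (not_not.mp hI)

/-- Only the two smallest elements can be exchanged, so `v` itself supplies the other thresholds; `n
- k + 1` is the largest possible second element. -/
theorem not_containsMonomial_of_pair_thresholds (h2 : 2 ≤ k) {v : KSubset k n} (u₀ u₁ : ℕ)
    (hu : ∀ x y, x < y → y ≤ n - k + 1 →
      (((x < l ∧ l ≤ y → u₁ ≤ x ∧ u₀ ≤ y) ∧ (¬ (x < l ∧ l ≤ y) → u₀ ≤ x ∧ u₁ ≤ y)) ↔
        ((v ⟨0, by omega⟩ : ℕ) ≤ x ∧ (v ⟨1, h2⟩ : ℕ) ≤ y))) :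
    ¬ ContainsMonomial (oppositeIdeal K l v) := by
  refine not_containsMonomial_of_thresholds
    (fun i => if (i : ℕ) = 0 then u₀ else if (i : ℕ) = 1 then u₁ else v i) fun I => ?_
  have h01 : (I ⟨0, by omega⟩ : ℕ) < I ⟨1, h2⟩ := I.strictMono (by simp)
  have hI := I.apply_le ⟨1, h2⟩
  simp only at hI
  have h := hu _ _ h01 hI
  have hsplit : ∀ p : Fin k → Prop, (∀ i, p i) ↔ (p ⟨0, by omega⟩ ∧ p ⟨1, h2⟩) ∧
      ∀ i : Fin k, 2 ≤ (i : ℕ) → p i := by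
    refine fun p => ⟨fun hp => ⟨⟨hp _, hp _⟩, fun i _ => hp i⟩, ?_⟩
    rintro ⟨⟨h0, h1⟩, hr⟩ ⟨i, hi⟩
    rcases i with _ | _ | i
    · exact h0
    · exact h1
    · exact hr _ (by simp)
  rw [KSubset.below_iff, hsplit, hsplit (fun i => (v i : ℕ) ≤ I i), ← h]
  by_cases hsw : (I ⟨0, by omega⟩ : ℕ) < l ∧ l ≤ (I ⟨1, h2⟩ : ℕ)
  · rw [matchingPerm_eq_swap h2 hsw.1 hsw.2, Equiv.swap_apply_left, Equiv.swap_apply_right]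
    refine and_congr (by simp [hsw]) (forall₂_congr fun i hi => ?_)
    rw [Equiv.swap_apply_of_ne_of_ne (by simp [Fin.ext_iff]; omega)
      (by simp [Fin.ext_iff]; omega), if_neg (by omega), if_neg (by omega)]
  · rw [matchingPerm_eq_one (by rintro ⟨_, h3⟩; exact hsw h3)]
    refine and_congr (by simp [hsw]) (forall₂_congr fun i hi => ?_)
    rw [Equiv.Perm.one_apply, if_neg (by omega), if_neg (by omega)]

theorem not_containsMonomial_of_lt_two (hk : k < 2) (v : KSubset k n) :
    ¬ ContainsMonomial (oppositeIdeal K l v) := by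
  refine not_containsMonomial_of_thresholds (fun i => v i) fun I => ?_
  rw [matchingPerm_eq_one (by rintro ⟨h, -⟩; omega), KSubset.below_iff]
  rfl

/-- Setting the variables of `S` to zero in `g` gives an element of the restricted ideal. If it were
zero, `g` would lie in the monomial ideal of `S`, contrary to the monomial `d`. -/
theorem restrictedIdeal_ne_bot {S : Set (KSubset k n)} {g : MvPolynomial (KSubset k n) K}
    (hg : g ∈ matchingFieldIdeal K k n l) {d : KSubset k n →₀ ℕ} (hd : d ∈ g.support)
    (hdS : ∀ I ∈ S, d I = 0) : restrictedIdeal K k n l S ≠ ⊥ := by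
  classical
  intro hbot
  set N : Ideal (MvPolynomial (KSubset k n) K) := Ideal.span ((fun I => X I) '' S)
  set f : MvPolynomial {I : KSubset k n // I ∉ S} K :=
    aeval (fun I => if h : I ∉ S then X ⟨I, h⟩ else 0) g
  have hhom : ((Ideal.Quotient.mkₐ K N).comp (rename Subtype.val)).comp
      (aeval (fun I => if h : I ∉ S then X ⟨I, h⟩ else 0)) = Ideal.Quotient.mkₐ K N := by
    ext I
    by_cases h : I ∈ S
    · have : (X I : MvPolynomial (KSubset k n) K) ∈ N := Ideal.subset_span ⟨I, h, rfl⟩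
      simpa [h] using (Ideal.Quotient.eq_zero_iff_mem.mpr this).symm
    · simp [h]
  have hfg : rename Subtype.val f - g ∈ N := by
    rw [← Ideal.Quotient.eq]
    exact DFunLike.congr_fun hhom g
  have hf : f ∈ restrictedIdeal K k n l S := by
    change rename Subtype.val f ∈ matchingFieldIdeal K k n l ⊔ N
    have := Ideal.add_mem _ ((le_sup_left : _ ≤ matchingFieldIdeal K k n l ⊔ N) hg)
      ((le_sup_right : N ≤ matchingFieldIdeal K k n l ⊔ N) hfg)
    rwa [add_sub_cancel] at this
  rw [hbot, Ideal.mem_bot] at hf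
  rw [hf, map_zero, zero_sub, neg_mem_iff] at hfg
  obtain ⟨I, hI, h0⟩ := mem_ideal_span_X_image.mp hfg d hd
  exact h0 (hdS I hI)

end Restriction

section Pairs

variable {k n l : ℕ} (K : Type*) [Field K]

/-- In the relation on `a, …, a+3` with `a = n-k-2`, the terms `ac·bd` and `ad·bc` involve only
surviving variables. -/
theorem oppositeIdeal_ne_bot (h2 : 2 ≤ k) (v : KSubset k n)
    (h0 : (v ⟨0, by omega⟩ : ℕ) + k + 2 ≤ n) (h1 : (v ⟨1, h2⟩ : ℕ) ≤ n - k) :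
    oppositeIdeal K l v ≠ ⊥ := by
  obtain ⟨a, rfl⟩ : ∃ a, n = a + k + 2 := ⟨n - k - 2, by omega⟩
  have hkn : k ≤ a + k + 2 := by omega
  obtain ⟨ab, hab⟩ := KSubset.exists_isPair hkn (x := a) (y := a + 1) (by omega) (by omega)
  obtain ⟨ac, hac⟩ := KSubset.exists_isPair hkn (x := a) (y := a + 2) (by omega) (by omega)
  obtain ⟨ad, had⟩ := KSubset.exists_isPair hkn (x := a) (y := a + 3) (by omega) (by omega)
  obtain ⟨bc, hbc⟩ := KSubset.exists_isPair hkn (x := a + 1) (y := a + 2) (by omega) (by omega)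
  obtain ⟨bd, hbd⟩ := KSubset.exists_isPair hkn (x := a + 1) (y := a + 3) (by omega) (by omega)
  obtain ⟨cd, hcd⟩ := KSubset.exists_isPair hkn (x := a + 2) (y := a + 3) (by omega) (by omega)
  have hmem : initialForm K (pluckerWeight K k _ l) _ ∈ matchingFieldIdeal K k _ l :=
    Ideal.subset_span ⟨_, threeTerm_mem_pluckerIdeal K h2 hkn hab hac had hbc hbd hcd, rfl⟩
  have e1 : Finsupp.single ac 1 + Finsupp.single bd 1 ≠
      (Finsupp.single ab 1 + Finsupp.single cd 1 : KSubset k (a + k + 2) →₀ ℕ) := by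
    intro h
    simpa [Finsupp.single_apply, hab.ne_of_right hac h2 (by omega),
      hcd.ne_of_left hac h2 (by omega)] using DFunLike.congr_fun h ac
  have e2 : Finsupp.single ac 1 + Finsupp.single bd 1 ≠
      (Finsupp.single ad 1 + Finsupp.single bc 1 : KSubset k (a + k + 2) →₀ ℕ) := by
    intro h
    simpa [Finsupp.single_apply, had.ne_of_right hac h2 (by omega),
      hbc.ne_of_left hac h2 (by omega)] using DFunLike.congr_fun h ac
  have e3 : Finsupp.single ab 1 + Finsupp.single cd 1 ≠
      (Finsupp.single ad 1 + Finsupp.single bc 1 : KSubset k (a + k + 2) →₀ ℕ) := by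
    intro h
    simpa [Finsupp.single_apply, had.ne_of_right hab h2 (by omega),
      hbc.ne_of_left hab h2 (by omega)] using DFunLike.congr_fun h ab
  have hpairs : ∀ {p q : KSubset k (a + k + 2)} {x y x' y' : ℕ}, p.IsPair x y → q.IsPair x' y' →
      a ≤ x → a + 2 ≤ y → a ≤ x' → a + 2 ≤ y' → ∀ I ∈ oppositeVanishing v,
      (Finsupp.single p 1 + Finsupp.single q 1 : KSubset k (a + k + 2) →₀ ℕ) I = 0 := by
    intro p q x y x' y' hp hq hx hy hx' hy' I hI
    have hpI : p ≠ I := by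
      rintro rfl
      exact hI ((hp.below_iff h2 v).mpr ⟨by omega, by omega⟩)
    have hqI : q ≠ I := by
      rintro rfl
      exact hI ((hq.below_iff h2 v).mpr ⟨by omega, by omega⟩)
    simp [hpI, hqI]
  -- For sums of minima over the three pairings of four numbers, the least value is attained at
  -- least twice. So `ab·cd` is never strictly lightest, and the lighter of the other two terms
  -- survives in the initial form.
  rcases le_total (min (secondRow (a + k + 2) l a) (secondRow (a + k + 2) l (a + 2)) +
      min (secondRow (a + k + 2) l (a + 1)) (secondRow (a + k + 2) l (a + 3)))
    (min (secondRow (a + k + 2) l a) (secondRow (a + k + 2) l (a + 3)) +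
      min (secondRow (a + k + 2) l (a + 1)) (secondRow (a + k + 2) l (a + 2))) with hw | hw
  · refine restrictedIdeal_ne_bot hmem (mem_support_initialForm_trinomial e1 e2 one_ne_zero ?_ ?_)
      (hpairs hac hbd le_rfl le_rfl (by omega) (by omega)) <;>
    · simp only [map_add, Finsupp.weight_single, one_smul, hab.pluckerWeight_eq h2,
        hac.pluckerWeight_eq h2, had.pluckerWeight_eq h2, hbc.pluckerWeight_eq h2,
        hbd.pluckerWeight_eq h2, hcd.pluckerWeight_eq h2]
      omega
  · rw [add_comm (monomial _ _ + monomial _ _), ← add_assoc] at hmem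
    refine restrictedIdeal_ne_bot hmem (mem_support_initialForm_trinomial e2.symm e3.symm
      (neg_ne_zero.mpr one_ne_zero) ?_ ?_)
      (hpairs had hbc le_rfl (by omega) (by omega) (by omega)) <;>
    · simp only [map_add, Finsupp.weight_single, one_smul, hab.pluckerWeight_eq h2,
        hac.pluckerWeight_eq h2, had.pluckerWeight_eq h2, hbc.pluckerWeight_eq h2,
        hbd.pluckerWeight_eq h2, hcd.pluckerWeight_eq h2]
      omega

/-- With `b = v₁ - 1` and `c = v₁`, the variable `ab` vanishes on restriction while `ac` and `bd`
survive. The initial form `ac·bd - ab·cd` therefore leaves the monomial `ac·bd`. -/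
theorem containsMonomial_oppositeIdeal (h2 : 2 ≤ k) (hkn : k ≤ n) (v : KSubset k n)
    (hl : l ≤ n - k + 1) (h0 : (v ⟨0, by omega⟩ : ℕ) < l) (h1 : (v ⟨1, h2⟩ : ℕ) ≤ n - k)
    (h01 : (v ⟨0, by omega⟩ : ℕ) + 2 ≤ v ⟨1, h2⟩) (hne : (v ⟨1, h2⟩ : ℕ) ≠ l) :
    ContainsMonomial (oppositeIdeal K l v) := by
  obtain ⟨a, ha⟩ : ∃ a, a = (v ⟨0, by omega⟩ : ℕ) := ⟨_, rfl⟩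
  obtain ⟨b, hb⟩ : ∃ b, (v ⟨1, h2⟩ : ℕ) = b + 1 := ⟨(v ⟨1, h2⟩ : ℕ) - 1, by omega⟩
  obtain ⟨d, hd⟩ : ∃ d, d = n - k + 1 := ⟨_, rfl⟩
  obtain ⟨ab, hab⟩ := KSubset.exists_isPair hkn (x := a) (y := b) (by omega) (by omega)
  obtain ⟨ac, hac⟩ := KSubset.exists_isPair hkn (x := a) (y := b + 1) (by omega) (by omega)
  obtain ⟨ad, had⟩ := KSubset.exists_isPair hkn (x := a) (y := d) (by omega) (by omega)
  obtain ⟨bc, hbc⟩ := KSubset.exists_isPair hkn (x := b) (y := b + 1) (by omega) (by omega)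
  obtain ⟨bd, hbd⟩ := KSubset.exists_isPair hkn (x := b) (y := d) (by omega) (by omega)
  obtain ⟨cd, hcd⟩ := KSubset.exists_isPair hkn (x := b + 1) (y := d) (by omega) (by omega)
  have e1 : Finsupp.single ac 1 + Finsupp.single bd 1 ≠
      (Finsupp.single ab 1 + Finsupp.single cd 1 : KSubset k n →₀ ℕ) := by
    intro h
    simpa [Finsupp.single_apply, hab.ne_of_right hac h2 (by omega),
      hcd.ne_of_left hac h2 (by omega)] using DFunLike.congr_fun h ac
  have e2 : Finsupp.single ac 1 + Finsupp.single bd 1 ≠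
      (Finsupp.single ad 1 + Finsupp.single bc 1 : KSubset k n →₀ ℕ) := by
    intro h
    simpa [Finsupp.single_apply, had.ne_of_right hac h2 (by omega),
      hbc.ne_of_left hac h2 (by omega)] using DFunLike.congr_fun h ac
  have hmem : initialForm K (pluckerWeight K k n l) _ ∈ matchingFieldIdeal K k n l :=
    Ideal.subset_span ⟨_, threeTerm_mem_pluckerIdeal K h2 hkn hab hac had hbc hbd hcd, rfl⟩
  rw [initialForm_trinomial e1 e2 one_ne_zero] at hmem
  · have hacT : ac ∉ oppositeVanishing v :=
      not_not.mpr ((hac.below_iff h2 v).mpr ⟨by omega, by omega⟩)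
    have hbdT : bd ∉ oppositeVanishing v :=
      not_not.mpr ((hbd.below_iff h2 v).mpr ⟨by omega, by omega⟩)
    have habS : ab ∈ oppositeVanishing v := fun h => by
      have := ((hab.below_iff h2 v).mp h).2
      omega
    refine ⟨Finsupp.single ⟨ac, hacT⟩ 1 + Finsupp.single ⟨bd, hbdT⟩ 1, ?_⟩
    change rename Subtype.val _ ∈ matchingFieldIdeal K k n l ⊔ _
    have hab' : (monomial (Finsupp.single ab 1 + Finsupp.single cd 1) (-1) :
        MvPolynomial (KSubset k n) K) ∈ Ideal.span ((fun I => X I) '' oppositeVanishing v) := by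
      have : (monomial (Finsupp.single ab 1 + Finsupp.single cd 1) (-1) :
          MvPolynomial (KSubset k n) K) = monomial (Finsupp.single cd 1) (-1) * X ab := by
        rw [X, monomial_mul, mul_one, add_comm]
      rw [this]
      exact Ideal.mul_mem_left _ _ (Ideal.subset_span ⟨ab, habS, rfl⟩)
    have := sub_mem (Ideal.mem_sup_left hmem) (Ideal.mem_sup_right hab')
    rw [add_sub_cancel_right] at this
    rw [rename_monomial, Finsupp.mapDomain_add, Finsupp.mapDomain_single, Finsupp.mapDomain_single]
    exact this
  -- Since `v₁ ≠ l`, `b` and `c` lie on the same side of the jump, while `a < l ≤ d`. Second-row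
  -- entries increase in the order `c, b, a, d` or `a, d, c, b`; in both cases `ad·bc` is strictly
  -- heavier than the other two, which tie.
  all_goals
    simp only [map_add, Finsupp.weight_single, one_smul, hab.pluckerWeight_eq h2,
      hac.pluckerWeight_eq h2, had.pluckerWeight_eq h2, hbc.pluckerWeight_eq h2,
      hbd.pluckerWeight_eq h2, hcd.pluckerWeight_eq h2, secondRow]
    split_ifs <;> omega

end Pairs

/-! ### Monomials determined by their content. -/

section Content

variable {k n l : ℕ}

/-- The multiplicity function of the elements of `J`. -/
noncomputable def KSubset.content (J : KSubset k n) : Fin n →₀ ℕ := ∑ i, Finsupp.single (J i) 1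

theorem KSubset.weight_content (t : Fin n → ℕ) (J : KSubset k n) :
    Finsupp.weight t J.content = ∑ i, t (J i) := by
  simp [KSubset.content, map_sum, Finsupp.weight_single]

theorem weight_weight_content (t : Fin n → ℕ) (m : KSubset k n →₀ ℕ) :
    Finsupp.weight t (Finsupp.weight KSubset.content m) =
      m.sum fun J c => c * ∑ i, t (J i) := by
  rw [Finsupp.weight_apply KSubset.content, Finsupp.sum, map_sum]
  simp only [map_nsmul, KSubset.weight_content, smul_eq_mul]
  rfl

theorem weight_content_eq_of_forall_eq {t : Fin n → ℕ} {m : KSubset k n →₀ ℕ} {N : ℕ}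
    (h : ∀ J ∈ m.support, ∑ i, t (J i) = N) :
    Finsupp.weight t (Finsupp.weight KSubset.content m) = m.degree * N := by
  rw [weight_weight_content, Finsupp.degree_apply, Finsupp.sum, Finset.sum_mul]
  exact Finset.sum_congr rfl fun J hJ => by rw [h J hJ]

theorem degree_eq_of_content_eq (hk : 1 ≤ k) {m m₀ : KSubset k n →₀ ℕ}
    (h : Finsupp.weight KSubset.content m = Finsupp.weight KSubset.content m₀) :
    m.degree = m₀.degree := by
  have h1 : ∀ m : KSubset k n →₀ ℕ,
      Finsupp.weight (fun _ => 1) (Finsupp.weight KSubset.content m) = m.degree * k := fun m =>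
    weight_content_eq_of_forall_eq fun J _ => by simp
  have := (h1 m).symm.trans ((congrArg _ h).trans (h1 m₀))
  exact Nat.eq_of_mul_eq_mul_right hk this

/-- A criterion for a monomial to be the only one with its content: its variables lie on the face
where the functional `t` is maximal, and their contents are separated by linear functionals. -/
theorem eq_of_content_eq (hk : 1 ≤ k) {m m₀ : KSubset k n →₀ ℕ} (t : Fin n → ℕ) (N : ℕ)
    (ht : ∀ J : KSubset k n, ∑ i, t (J i) ≤ N)
    (hu : ∀ J₀ : KSubset k n, ∑ i, t (J₀ i) = N → ∃ (u : Fin n → ℕ) (α : ℕ),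
      ∀ J : KSubset k n, ∑ i, t (J i) = N → ∑ i, u (J i) = α + if J = J₀ then 1 else 0)
    (hm₀ : ∀ J ∈ m₀.support, ∑ i, t (J i) = N)
    (h : Finsupp.weight KSubset.content m = Finsupp.weight KSubset.content m₀) : m = m₀ := by
  have hdeg := degree_eq_of_content_eq hk h
  have hm : ∀ J ∈ m.support, ∑ i, t (J i) = N := by
    have h1 := (congrArg (Finsupp.weight t) h).trans (weight_content_eq_of_forall_eq hm₀)
    -- Each variable contributes at most `N` per unit of degree and the total is the maximum, so
    -- equality holds for every variable of `m`.
    rw [weight_weight_content, ← hdeg, Finsupp.degree_apply, Finsupp.sum, Finset.sum_mul] at h1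
    intro J hJ
    have h2 := (Finset.sum_eq_sum_iff_of_le fun J _ => Nat.mul_le_mul_left (m J) (ht J)).mp h1 J hJ
    exact Nat.eq_of_mul_eq_mul_left (Nat.pos_of_ne_zero (Finsupp.mem_support_iff.mp hJ)) h2
  ext J₀
  by_cases hJ₀ : ∑ i, t (J₀ i) = N
  · obtain ⟨u, α, hα⟩ := hu J₀ hJ₀
    have key : ∀ p : KSubset k n →₀ ℕ, (∀ J ∈ p.support, ∑ i, t (J i) = N) →
        Finsupp.weight u (Finsupp.weight KSubset.content p) = p.degree * α + p J₀ := by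
      intro p hp
      rw [weight_weight_content, Finsupp.degree_apply, Finsupp.sum, Finset.sum_mul]
      have : p J₀ = ∑ J ∈ p.support, p J * if J = J₀ then 1 else 0 := by simp
      rw [this, ← Finset.sum_add_distrib]
      exact Finset.sum_congr rfl fun J hJ => by rw [hα J (hp J hJ), mul_add]
    have := (key m hm).symm.trans ((congrArg _ h).trans (key m₀ hm₀))
    rw [hdeg] at this
    omega
  · rw [Finsupp.notMem_support_iff.mp fun hJ => hJ₀ (hm _ hJ),
      Finsupp.notMem_support_iff.mp fun hJ => hJ₀ (hm₀ _ hJ)]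

/-- A monomial in subsets of the form `{j, n-k+2, …, n}` is determined by its content. -/
theorem eq_of_content_eq_of_top (hk : 1 ≤ k) {m m₀ : KSubset k n →₀ ℕ}
    (hm₀ : ∀ J ∈ m₀.support, ∀ i : Fin k, 1 ≤ (i : ℕ) → (J i : ℕ) = n - k + i)
    (h : Finsupp.weight KSubset.content m = Finsupp.weight KSubset.content m₀) : m = m₀ := by
  have hle : ∀ (J : KSubset k n) (i : Fin k), (J i : ℕ) - (n - k) ≤ i := fun J i => by
    have := J.apply_le i
    omega
  have hiff : ∀ J : KSubset k n, ∑ i, ((J i : ℕ) - (n - k)) = ∑ i : Fin k, (i : ℕ) ↔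
      ∀ i : Fin k, 1 ≤ (i : ℕ) → (J i : ℕ) = n - k + i := by
    intro J
    rw [Finset.sum_eq_sum_iff_of_le fun i _ => hle J i]
    refine ⟨fun hJ i hi => ?_, fun hJ i _ => ?_⟩
    · have := hJ i (Finset.mem_univ i)
      omega
    · rcases Nat.eq_zero_or_pos (i : ℕ) with h0 | h0
      · have := J.apply_le i
        omega
      · rw [hJ i h0]
        omega
  -- With truncated subtraction the `i`-th element contributes at most `i`; the maximum is reached
  -- exactly when all elements but the least are the largest possible.
  refine eq_of_content_eq hk (fun j => (j : ℕ) - (n - k)) (∑ i : Fin k, (i : ℕ))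
    (fun J => Finset.sum_le_sum fun i _ => hle J i) (fun J₀ hJ₀ => ?_)
    (fun J hJ => (hiff J).mpr (hm₀ J hJ)) h
  rw [hiff] at hJ₀
  -- On this face a set is known from its least element, which `u` detects.
  refine ⟨fun j => if j = J₀ ⟨0, hk⟩ then 1 else 0, 0, fun J hJ => ?_⟩
  rw [hiff] at hJ
  rw [zero_add, Finset.sum_eq_single_of_mem ⟨0, hk⟩ (Finset.mem_univ _)]
  · refine if_congr ⟨fun h0 => ?_, fun h0 => by rw [h0]⟩ rfl rfl
    ext i
    rcases Nat.eq_zero_or_pos (i : ℕ) with hi | hi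
    · rw [show i = ⟨0, hk⟩ from Fin.ext hi, h0]
    · rw [hJ i hi, hJ₀ i hi]
  · intro i _ hi
    have hi' : 1 ≤ (i : ℕ) := Nat.pos_of_ne_zero fun h0 => hi (Fin.ext h0)
    have h1 := J₀.apply_le ⟨0, hk⟩
    have h2 := hJ i hi'
    simp only at h1
    refine if_neg fun h0 => ?_
    rw [h0] at h2
    omega

/-- A monomial in `k`-subsets of the `k + 1` largest elements is determined by its content. -/
theorem eq_of_content_eq_of_last (hk : 1 ≤ k) {m m₀ : KSubset k n →₀ ℕ}
    (hm₀ : ∀ J ∈ m₀.support, ∀ i : Fin k, n - k - 1 ≤ (J i : ℕ))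
    (h : Finsupp.weight KSubset.content m = Finsupp.weight KSubset.content m₀) : m = m₀ := by
  classical
  have hle : ∀ (J : KSubset k n) (i : Fin k), (if n - k - 1 ≤ (J i : ℕ) then 1 else 0) ≤ 1 := by
    intro J i
    split_ifs <;> omega
  have hiff : ∀ J : KSubset k n, ∑ i, (if n - k - 1 ≤ (J i : ℕ) then 1 else 0) = ∑ i : Fin k, 1 ↔
      ∀ i : Fin k, n - k - 1 ≤ (J i : ℕ) := by
    intro J
    rw [Finset.sum_eq_sum_iff_of_le fun i _ => hle J i]
    simp
  refine eq_of_content_eq hk (fun j => if n - k - 1 ≤ (j : ℕ) then 1 else 0) (∑ i : Fin k, 1)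
    (fun J => Finset.sum_le_sum fun i _ => hle J i) (fun J₀ hJ₀ => ?_)
    (fun J hJ => (hiff J).mpr (hm₀ J hJ)) h
  rw [hiff] at hJ₀
  let im : KSubset k n → Finset (Fin n) := fun J => Finset.univ.map J.toEmbedding
  have him : ∀ J, (im J).card = k := fun J => by simp [im]
  let big : Finset (Fin n) := Finset.univ.filter fun j => n - k - 1 ≤ (j : ℕ)
  have hsub : ∀ J : KSubset k n, (∀ i : Fin k, n - k - 1 ≤ (J i : ℕ)) → im J ⊆ big := by
    intro J hJ j hj
    obtain ⟨i, -, rfl⟩ := Finset.mem_map.mp hj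
    simpa [big] using hJ i
  have hbig : big.card ≤ k + 1 := by
    have : big.card ≤ (Finset.Ico (n - k - 1) n).card :=
      Finset.card_le_card_of_injOn (fun j => (j : ℕ))
        (fun j hj => by simpa [big] using hj) (Fin.val_injective.injOn)
    rw [Nat.card_Ico] at this
    omega
  have hinj : ∀ J J' : KSubset k n, im J = im J' → J = J' := by
    intro J J' hJ
    rw [← OrderEmbedding.range_inj]
    simpa [im] using congrArg (fun s : Finset (Fin n) => (s : Set (Fin n))) hJ
  -- Two distinct `k`-subsets of a set of `k + 1` elements meet in exactly `k - 1` elements, so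
  -- counting elements of `J₀` separates `J₀` from the rest.
  refine ⟨fun j => if j ∈ im J₀ then 1 else 0, k - 1, fun J hJ => ?_⟩
  rw [hiff] at hJ
  have hcount : ∑ i, (if J i ∈ im J₀ then 1 else 0) = (im J ∩ im J₀).card := by
    have : im J ∩ im J₀ = (im J).filter (· ∈ im J₀) := by ext; simp
    rw [this, Finset.card_filter, Finset.sum_map]
    rfl
  rw [hcount]
  by_cases he : J = J₀
  · rw [if_pos he, he, Finset.inter_self, him]
    omega
  · rw [if_neg he, add_zero]
    have h1 := Finset.card_union_add_card_inter (im J) (im J₀)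
    have h2 := Finset.card_le_card (Finset.union_subset (hsub J hJ) (hsub J₀ hJ₀))
    rw [him, him] at h1
    have h3 : (im J ∩ im J₀).card < k := by
      by_contra! hcon
      have e1 := Finset.eq_of_subset_of_card_le (Finset.inter_subset_left (s₁ := im J) (s₂ := im J₀))
        (by rwa [him])
      have e2 := Finset.eq_of_subset_of_card_le
        (Finset.inter_subset_right (s₁ := im J) (s₂ := im J₀)) (by rwa [him])
      exact he (hinj _ _ (e1.symm.trans e2))
    omega

variable {K : Type*} [Field K]

/-- At the matrix with entries `X j` in column `j`, a monomial in the Plücker variables becomes `±`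
the monomial given by its content, so nothing can cancel the term of `m₀`. -/
theorem coeff_eq_zero_of_content_unique {g : MvPolynomial (KSubset k n) K}
    (hg : g ∈ matchingFieldIdeal K k n l) {m₀ : KSubset k n →₀ ℕ}
    (h : ∀ m : KSubset k n →₀ ℕ, Finsupp.weight KSubset.content m =
      Finsupp.weight KSubset.content m₀ → m = m₀) : coeff m₀ g = 0 := by
  classical
  let s : KSubset k n → K := fun J => ((Equiv.Perm.sign (matchingPerm l J) : ℤ) : K)
  have hval : ∀ J : KSubset k n,
      initialValue l (fun p => (X p.2 : MvPolynomial (Fin n) K)) J = monomial J.content (s J) := by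
    intro J
    rw [initialValue, KSubset.content, ← mul_one (s J), ← C_mul_monomial, monomial_sum_one]
    simp [s, X]
  have hmon : ∀ (m : KSubset k n →₀ ℕ) (c : K),
      aeval (initialValue l (fun p => (X p.2 : MvPolynomial (Fin n) K))) (monomial m c) =
      monomial (Finsupp.weight KSubset.content m) (c * ∏ J ∈ m.support, s J ^ m J) := by
    intro m c
    rw [aeval_monomial, Finsupp.prod]
    simp only [hval, monomial_pow]
    rw [← monomial_sum_prod, algebraMap_eq, C_mul_monomial, Finsupp.weight_apply]
    rfl
  have h0 := congrArg (coeff (Finsupp.weight KSubset.content m₀))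
    (aeval_initialValue_eq_zero (fun p => (X p.2 : MvPolynomial (Fin n) K)) hg)
  rw [g.as_sum, map_sum, coeff_sum, coeff_zero] at h0
  by_contra hne
  rw [Finset.sum_eq_single_of_mem m₀ (mem_support_iff.mpr hne)] at h0
  · rw [hmon, coeff_monomial, if_pos rfl] at h0
    rcases mul_eq_zero.mp h0 with h1 | h1
    · exact hne h1
    · obtain ⟨J, -, hJ⟩ := Finset.prod_eq_zero_iff.mp h1
      have hs := eq_zero_of_pow_eq_zero hJ
      rcases Int.units_eq_one_or (Equiv.Perm.sign (matchingPerm l J)) with hu | hu <;>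
        simp [s, hu] at hs
  · intro m _ hm
    rw [hmon, coeff_monomial, if_neg fun he => hm (h m he)]

theorem restrictedIdeal_eq_bot {S : Set (KSubset k n)}
    (h : ∀ m₀ m : KSubset k n →₀ ℕ, (∀ J ∈ m₀.support, J ∉ S) →
      Finsupp.weight KSubset.content m = Finsupp.weight KSubset.content m₀ → m = m₀) :
    restrictedIdeal K k n l S = ⊥ := by
  rw [eq_bot_iff]
  intro f hf
  rw [Ideal.mem_bot]
  ext d
  have hf' : rename Subtype.val f ∈
      matchingFieldIdeal K k n l ⊔ Ideal.span ((fun I => X I) '' S) := hf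
  obtain ⟨g, hg, r, hr, hgr⟩ := Submodule.mem_sup.mp hf'
  have hd : ∀ J ∈ (d.mapDomain Subtype.val).support, J ∉ S := by
    classical
    intro J hJ
    obtain ⟨I, -, rfl⟩ := Finset.mem_image.mp (Finsupp.mapDomain_support hJ)
    exact I.2
  rw [← coeff_rename_mapDomain _ Subtype.val_injective, ← hgr, coeff_add,
    coeff_eq_zero_of_content_unique hg fun m => h _ m hd, zero_add, coeff_zero]
  by_contra hne
  obtain ⟨I, hI, h0⟩ := mem_ideal_span_X_image.mp hr _ (mem_support_iff.mpr hne)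
  exact hd I (Finsupp.mem_support_iff.mpr h0) hI

end Content

/-! ### The vanishing criterion in terms of the two smallest elements. -/

section Zero

variable {k n l : ℕ}

theorem KSubset.card_toFinset (u : KSubset k n) : u.toFinset.card = k := by
  rw [KSubset.toFinset, Finset.card_image_of_injective, Finset.card_univ, Fintype.card_fin]
  intro a b h
  simp only [KSubset.entry] at h
  exact u.injective (Fin.ext (by omega))

theorem KSubset.le_apply (u : KSubset k n) (i : Fin k) : (i : ℕ) ≤ u i := by
  have h := u.add_le_apply i 0 (by omega)
  have h2 : (⟨0 + (i : ℕ), by omega⟩ : Fin k) = i := Fin.ext (Nat.zero_add _)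
  rw [h2] at h
  omega

theorem KSubset.entry_mem_toFinset (u : KSubset k n) (i : Fin k) : (u i : ℕ) + 1 ∈ u.toFinset :=
  Finset.mem_image_of_mem u.entry (Finset.mem_univ i)

/-- The alternatives say that the first `k - 1` elements are the smallest possible, which is vacuous
for `k = 1`, or that the set lies in `{1, …, k+1}`. -/
theorem KSubset.toFinset_mem_Zset_iff (hk : 1 ≤ k) (u : KSubset k n) :
    u.toFinset ∈ Zset k n ↔
      (∀ h2 : 2 ≤ k, (u ⟨k - 2, by omega⟩ : ℕ) ≤ k - 2) ∨ (u ⟨k - 1, by omega⟩ : ℕ) ≤ k := by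
  have hmem := u.entry_mem_toFinset
  have hlast := u.le_apply ⟨k - 1, by omega⟩
  have hmono : ∀ (i : Fin k) (j : ℕ) (hj : j < k), (i : ℕ) ≤ j → (u i : ℕ) ≤ u ⟨j, hj⟩ :=
    fun i j hj h => u.monotone (show i ≤ ⟨j, hj⟩ from h)
  simp only at hlast
  constructor
  · rintro (⟨i, hi, -, h⟩ | ⟨i, -, -, h⟩)
    · left
      intro h2
      have hlt : (u ⟨k - 2, by omega⟩ : ℕ) < u ⟨k - 1, by omega⟩ :=
        u.strictMono (by rw [Fin.mk_lt_mk]; omega)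
      have h1 := hmem ⟨k - 2, by omega⟩
      have h2 := hmem ⟨k - 1, by omega⟩
      rw [h, Finset.mem_insert, Finset.mem_Icc] at h1 h2
      omega
    · right
      have h1 := hmem ⟨k - 1, by omega⟩
      rw [h, Finset.mem_erase, Finset.mem_Icc] at h1
      omega
  · intro h
    by_cases hc : ∀ h2 : 2 ≤ k, (u ⟨k - 2, by omega⟩ : ℕ) ≤ k - 2
    · left
      refine ⟨(u ⟨k - 1, by omega⟩ : ℕ) + 1, by omega, (u _).isLt, ?_⟩
      refine Finset.eq_of_subset_of_card_le ?_ ?_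
      · intro x hx
        obtain ⟨i, -, rfl⟩ := Finset.mem_image.mp hx
        rw [KSubset.entry, Finset.mem_insert, Finset.mem_Icc]
        by_cases hi : (i : ℕ) = k - 1
        · left
          rw [show i = ⟨k - 1, by omega⟩ from Fin.ext hi]
        · have h2 : 2 ≤ k := by omega
          have := hmono i (k - 2) (by omega) (by omega)
          have := hc h2
          omega
      · rw [u.card_toFinset]
        refine (Finset.card_insert_le _ _).trans ?_
        rw [Nat.card_Icc]
        omega
    · have hle := h.resolve_left hc
      push Not at hc
      obtain ⟨h2, hc⟩ := hc
      have hlt : (u ⟨k - 2, by omega⟩ : ℕ) < u ⟨k - 1, by omega⟩ :=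
        u.strictMono (by rw [Fin.mk_lt_mk]; omega)
      have hsub : u.toFinset ⊆ Finset.Icc 1 (k + 1) := by
        intro x hx
        obtain ⟨i, -, rfl⟩ := Finset.mem_image.mp hx
        have := hmono i (k - 1) (by omega) (by omega)
        rw [KSubset.entry, Finset.mem_Icc]
        omega
      -- The missing element `i` is at most `k - 1`: the failure of the first alternative forces the
      -- two largest entries to be `k` and `k + 1`.
      obtain ⟨i, hi, hiu⟩ := Finset.exists_mem_notMem_of_card_lt_card
        (s := u.toFinset) (t := Finset.Icc 1 (k + 1)) (by rw [u.card_toFinset, Nat.card_Icc]; omega)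
      have hne : ∀ j, i ≠ (u j : ℕ) + 1 := by
        rintro j rfl
        exact hiu (hmem j)
      have h3 := hne ⟨k - 2, by omega⟩
      have h4 := hne ⟨k - 1, by omega⟩
      rw [Finset.mem_Icc] at hi
      refine Or.inr ⟨i, hi.1, by omega, ?_⟩
      refine Finset.eq_of_subset_of_card_le
        (fun x hx => Finset.mem_erase.mpr ⟨fun e => hiu (e ▸ hx), hsub hx⟩) ?_
      rw [u.card_toFinset, Finset.card_erase_of_mem (Finset.mem_Icc.mpr hi), Nat.card_Icc]
      omega

theorem KSubset.w0_toFinset_mem_Zset_iff (hk : 1 ≤ k) (v : KSubset k n) :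
    v.w0.toFinset ∈ Zset k n ↔
      (∀ h2 : 2 ≤ k, n - k < (v ⟨1, h2⟩ : ℕ)) ∨ n < (v ⟨0, hk⟩ : ℕ) + k + 2 := by
  have hlast : (v.w0 ⟨k - 1, by omega⟩ : ℕ) = n - 1 - v ⟨0, hk⟩ := by
    have : Fin.rev (⟨k - 1, by omega⟩ : Fin k) = ⟨0, hk⟩ := by
      ext
      simp only [Fin.val_rev]
      omega
    rw [KSubset.w0_apply, this, Fin.val_rev]
    omega
  have hpen : ∀ h2 : 2 ≤ k, (v.w0 ⟨k - 2, by omega⟩ : ℕ) = n - 1 - v ⟨1, h2⟩ := by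
    intro h2
    have : Fin.rev (⟨k - 2, by omega⟩ : Fin k) = ⟨1, h2⟩ := by
      ext
      simp only [Fin.val_rev]
      omega
    rw [KSubset.w0_apply, this, Fin.val_rev]
    omega
  have hkn : k ≤ n := by simpa using Fintype.card_le_of_embedding v.toEmbedding
  rw [KSubset.toFinset_mem_Zset_iff hk]
  refine or_congr (forall_congr' fun h2 => ?_) ?_
  · have := (v ⟨1, h2⟩).isLt
    rw [hpen h2]
    omega
  · have := (v ⟨0, hk⟩).isLt
    rw [hlast]
    omega

theorem oppositeIdeal_eq_bot_iff (K : Type*) [Field K] (hk : 1 ≤ k) (v : KSubset k n) :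
    oppositeIdeal K l v = ⊥ ↔
      (∀ h2 : 2 ≤ k, n - k < (v ⟨1, h2⟩ : ℕ)) ∨ n < (v ⟨0, hk⟩ : ℕ) + k + 2 := by
  constructor
  · intro h
    by_contra! hcon
    obtain ⟨⟨h2, h1⟩, h0⟩ := hcon
    exact oppositeIdeal_ne_bot K h2 v h0 h1 h
  · have hT : ∀ J : KSubset k n, J ∉ oppositeVanishing v → ∀ i, (v i : ℕ) ≤ J i := fun J hJ =>
      (v.below_iff J).mp (not_not.mp hJ)
    rintro (h | h)
    · refine restrictedIdeal_eq_bot fun m₀ m hm₀ => eq_of_content_eq_of_top hk fun J hJ i hi => ?_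
      have h2 : 2 ≤ k := by omega
      have h3 := hT J (hm₀ J hJ) ⟨1, h2⟩
      have h4 := J.add_le_apply (i - 1) 1 (by omega)
      have h5 : (⟨1 + ((i : ℕ) - 1), by omega⟩ : Fin k) = i :=
        Fin.ext (by simp only; omega)
      have h6 := J.apply_le i
      have h7 := h h2
      rw [h5] at h4
      omega
    · refine restrictedIdeal_eq_bot fun m₀ m hm₀ => eq_of_content_eq_of_last hk fun J hJ i => ?_
      have h3 := hT J (hm₀ J hJ) ⟨0, hk⟩
      have h4 : (J ⟨0, hk⟩ : ℕ) ≤ J i := J.monotone (show (⟨0, hk⟩ : Fin k) ≤ i from Nat.zero_le _)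
      omega

end Zero

theorem mainTheorem5 {K : Type*} [Field K] [CharZero K] (k n l : ℕ)
    (hk : 1 ≤ k) (hkn : k ≤ n) (hl : l ≤ n) (v : KSubset k n) :
    (ContainsMonomial (oppositeIdeal K l v) ↔
      oppositeIdeal K l v ≠ ⊥ ∧
      (1 ≤ l ∧ l ≤ n - k + 1) ∧
      v.entry ⟨0, hk⟩ ∈ Finset.Icc 1 l ∧
      ∃ h2 : 2 ≤ k,
        v.entry ⟨1, h2⟩ ∈ Finset.Icc (v.entry ⟨0, hk⟩ + 2) n \ {l + 1}) ∧
    (oppositeIdeal K l v = ⊥ ↔ v.w0.toFinset ∈ Zset k n) := by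
  have hbot := oppositeIdeal_eq_bot_iff (l := l) K hk v
  refine ⟨⟨fun h => ⟨?_, ?_⟩, ?_⟩, hbot.trans (v.w0_toFinset_mem_Zset_iff hk).symm⟩
  · intro hb
    obtain ⟨m, hm⟩ := h
    rw [hb, Ideal.mem_bot, monomial_eq_zero] at hm
    exact one_ne_zero hm
  · have h2 : 2 ≤ k := by
      by_contra h2
      exact not_containsMonomial_of_lt_two (by omega) v h
    have h01 : (v ⟨0, hk⟩ : ℕ) < v ⟨1, h2⟩ := v.strictMono (by simp)
    have h1n := (v ⟨1, h2⟩).isLt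
    -- In the first two cases no exchange ever occurs. If `l ≤ v₀`, an exchange means `x < v₀`, and
    -- both sides fail.
    have hgen : ¬ (l = 0 ∨ n - k + 1 < l ∨ l ≤ (v ⟨0, hk⟩ : ℕ)) := fun hc =>
      not_containsMonomial_of_pair_thresholds h2 (v ⟨0, hk⟩) (v ⟨1, h2⟩)
        (fun x y hxy hy => by omega) h
    -- Equal thresholds make the exchange irrelevant, and `v₀ ≤ x < y` already gives `v₀ + 1 ≤ y`.
    have hadj : (v ⟨1, h2⟩ : ℕ) ≠ v ⟨0, hk⟩ + 1 := fun hc =>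
      not_containsMonomial_of_pair_thresholds h2 (v ⟨0, hk⟩) (v ⟨0, hk⟩)
        (fun x y hxy hy => by omega) h
    -- The thresholds are exchanged: if `x < l ≤ y` they match `v` directly, and otherwise `l ≤ y`
    -- is equivalent to `l ≤ x`.
    have hjump : (v ⟨1, h2⟩ : ℕ) ≠ l := fun hc =>
      not_containsMonomial_of_pair_thresholds h2 (v ⟨1, h2⟩) (v ⟨0, hk⟩)
        (fun x y hxy hy => by omega) h
    refine ⟨by omega, ?_, h2, ?_⟩
    · rw [KSubset.entry, Finset.mem_Icc]
      omega
    · rw [KSubset.entry, KSubset.entry, Finset.mem_sdiff, Finset.mem_Icc, Finset.mem_singleton]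
      omega
  -- Nonvanishing supplies the bound `v₁ ≤ n - k`, needed for `v₁` to lie strictly below the fourth
  -- element `n - k + 1`.
  · rintro ⟨hne, ⟨-, hln⟩, h0, h2, h1⟩
    rw [ne_eq, hbot] at hne
    push Not at hne
    obtain ⟨⟨_, h3⟩, -⟩ := hne
    rw [KSubset.entry, Finset.mem_Icc] at h0
    rw [KSubset.entry, KSubset.entry, Finset.mem_sdiff, Finset.mem_Icc, Finset.mem_singleton] at h1
    exact containsMonomial_oppositeIdeal K h2 hkn v hln (by omega) h3 (by omega) (by omega)
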